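/- All graphs are finite and simple. A labeling $v_1,\dots,v_n$ of the vertices of a graph $G=(V,E)$ (each vertex being listed exactly once) is *non-jumping* if, whenever $i<j<k<l$ and $v_iv_k,\,v_jv_l\in E$, also $v_jv_k\in E$; $G$ is *non-jumping* if it has a non-jumping labeling. $G$ is *chordal* if its vertices can be ordered $v_1,\dots,v_n$ so that for every $i$ the vertex $v_i$ and its neighbours among $v_1,\dots,v_{i-1}$ form a clique. The *bull* is a triangle with two pendant vertices attached to two different vertices of it; the *dart* is $K_4$ minus an edge with a pendant vertex attached to a vertex of degree three; the *gem* is a path on four vertices together with a vertex adjacent to all of them. $G$ is *$(\text{bull},\text{dart},\text{gem})$-free* if none of these is isomorphic to an induced subgraph of $G$. A *leaf* of a tree is a vertex of degree at most one. A tree $T$, with a bijection between $V$ and the leaves of $T$, is a *3-leaf root* of $G$ if two distinct vertices of $G$ are adjacent precisely when the corresponding leaves have distance at most $3$ in $T$; $G$ is a *3-leaf power* if it has a 3-leaf root. **Theorem.** Let $G$ be a $(\text{bull},\text{dart},\text{gem})$-free chordal graph. Then: 1. $G$ is a non-jumping graph. 2. If $G$ has at least one vertex, then $G$ is a 3-leaf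 power. 3. Let $T$ be any 3-leaf root of $G$, rooted at a non-leaf vertex $x$. Then the children of each vertex of $T$ can be ordered so that the depths (heights) of the subtrees rooted at them are weakly increasing; and for every such ordering, the depth-first search of $T$ from $x$ that visits children in this order meets every leaf exactly once, and the order in which it meets the leaves, read as an ordering of the corresponding vertices of $G$, is a non-jumping labeling of $G$. -/

import Mathlib

namespace NonJumping

variable {V W : Type*}

/-- The bull: the triangle `0, 1, 2` with a pendant vertex `3` attached to `0` and a pendant
vertex `4` attached to `1`. -/
def bull : SimpleGraph (Fin 5) :=
  SimpleGraph.fromEdgeSet {s(0, 1), s(0, 2), s(1, 2), s(0, 3), s(1, 4)}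

/-- The dart: the diamond on `0, 1, 2, 3` (where `2, 3` are the two nonadjacent vertices) with
a pendant vertex `4` attached to the vertex `0` of degree three in the diamond. -/
def dart : SimpleGraph (Fin 5) :=
  SimpleGraph.fromEdgeSet {s(0, 1), s(0, 2), s(0, 3), s(1, 2), s(1, 3), s(0, 4)}

/-- The gem: the path `0, 1, 2, 3` together with a vertex `4` adjacent to all of it. -/
def gem : SimpleGraph (Fin 5) :=
  SimpleGraph.fromEdgeSet
    {s(0, 1), s(1, 2), s(2, 3), s(0, 4), s(1, 4), s(2, 4), s(3, 4)}

/-- No induced subgraph of `G` is isomorphic to `H`. -/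
def IsFree (H : SimpleGraph W) (G : SimpleGraph V) : Prop :=
  ¬ H.IsIndContained G

/-- `v` together with its neighbours induces a complete graph. -/
def IsSimplicial (G : SimpleGraph V) (v : V) : Prop :=
  G.IsClique (insert v (G.neighborSet v))

/-- Each `γ i` is simplicial in the subgraph induced by the vertices `γ j` with `j ≤ i`. -/
def IsPerfectEliminationOrdering {n : ℕ} (G : SimpleGraph V) (γ : Fin n ≃ V) : Prop :=
  ∀ i : Fin n,
    IsSimplicial (G.induce (γ '' Set.Iic i)) ⟨γ i, Set.mem_image_of_mem γ (Set.self_mem_Iic)⟩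

/-- A finite graph is chordal if it has a perfect elimination ordering. -/
def IsChordal [Fintype V] (G : SimpleGraph V) : Prop :=
  ∃ γ : Fin (Fintype.card V) ≃ V, IsPerfectEliminationOrdering G γ

/-- Whenever `i < j < k < l` and `γ i γ k`, `γ j γ l` are edges, so is `γ j γ k`. -/
def IsNonJumpingLabeling {n : ℕ} (G : SimpleGraph V) (γ : Fin n ≃ V) : Prop :=
  ∀ i j k l : Fin n, i < j → j < k → k < l →
    G.Adj (γ i) (γ k) → G.Adj (γ j) (γ l) → G.Adj (γ j) (γ k)

/-- A finite graph is non-jumping if it has a non-jumping labeling. -/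
def IsNonJumping [Fintype V] (G : SimpleGraph V) : Prop :=
  ∃ γ : Fin (Fintype.card V) ≃ V, IsNonJumpingLabeling G γ

/-- A leaf of a tree is a vertex with at most one neighbour. In a tree with at least two vertices
this says that the degree is one; the only vertex of the one-vertex tree is also a leaf. -/
def IsLeaf (T : SimpleGraph W) (w : W) : Prop :=
  (T.neighborSet w).Subsingleton

/-- `T` is a tree, and `φ` is a bijection of the vertices of `G` with the leaves of `T` under
which two vertices of `G` are adjacent precisely if their distance in `T` is at most `k`. -/
structure IsLeafRoot (k : ℕ) (G : SimpleGraph V) (T : SimpleGraph W)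
    (φ : V ≃ {w : W // IsLeaf T w}) : Prop where
  isTree : T.IsTree
  adj_iff : ∀ u v : V, u ≠ v → (G.Adj u v ↔ T.dist (φ u : W) (φ v : W) ≤ k)

/-- `G` is a `k`-leaf power of some finite tree. -/
def IsLeafPower (k : ℕ) (G : SimpleGraph V) : Prop :=
  ∃ (m : ℕ) (T : SimpleGraph (Fin m)) (φ : V ≃ {w : Fin m // IsLeaf T w}), IsLeafRoot k G T φ

/-- In the tree `T` rooted at `x`, the vertex `c` is a child of `v`. -/
def IsChild (T : SimpleGraph W) (x v c : W) : Prop :=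
  T.Adj v c ∧ T.dist x c = T.dist x v + 1

/-- In the tree `T` rooted at `x`, the vertex `w` belongs to the subtree rooted at `v`, that is,
`v` lies on the path from `x` to `w`. -/
def InSubtree (T : SimpleGraph W) (x v w : W) : Prop :=
  T.dist x w = T.dist x v + T.dist v w

open Classical in
/-- In the tree `T` rooted at `x`, the depth of the subtree rooted at `v`: the largest distance
from `v` to a vertex of that subtree. -/
noncomputable def subtreeDepth [Fintype W] (T : SimpleGraph W) (x v : W) : ℕ :=
  (Finset.univ.filter (fun w : W => InSubtree T x v w)).sup (fun w => T.dist v w)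

/-- `ch` lists the children of every vertex of the tree `T` rooted at `x`, each of them once, in
an order in which the depths of the subtrees rooted at them ascend (weakly). -/
structure IsDepthSorted [Fintype W] (T : SimpleGraph W) (x : W) (ch : W → List W) : Prop where
  nodup : ∀ v, (ch v).Nodup
  mem_iff : ∀ v c, c ∈ ch v ↔ IsChild T x v c
  sorted : ∀ v, (ch v).Pairwise (fun a b => subtreeDepth T x a ≤ subtreeDepth T x b)

open Classical in
/-- The leaves in the order in which depth-first search from `v` meets them, if the children of
each vertex are visited in the order `ch`. The first argument bounds the recursion depth. -/
noncomputable def dfsLeaves (T : SimpleGraph W) (ch : W → List W) : ℕ → W → List W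
  | 0, _ => []
  | k + 1, v => if IsLeaf T v then [v] else (ch v).flatMap (fun c => dfsLeaves T ch k c)

/-- The DFS leaf order of the whole tree `T` rooted at `x`. The recursion bound is the number of
vertices, which exceeds the depth of the tree. -/
noncomputable def dfsLeafOrder [Fintype W] (T : SimpleGraph W) (x : W) (ch : W → List W) :
    List W :=
  dfsLeaves T ch (Fintype.card W) x

end NonJumping

namespace NonJumping

/-! ### Rooted trees -/

section RootedTree

variable {W : Type*} {T : SimpleGraph W} {x : W}

/-! Structure: in a chordal graph without bull, dart and gem, every triangle contains two twins,
that is, vertices with equal closed neighbourhoods (`false_of_triangle_without_twins`). Hence one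
representative from each twin class induces a triangle-free subgraph. In a perfect elimination
ordering the earlier neighbours of a vertex form a clique, so each representative has at most one
earlier neighbour among the representatives: they induce a forest, and `G` arises from it by blowing
up vertices into cliques. A 3-leaf root is this forest, made connected by paths long enough to
create no adjacency, with one leaf hung on the representative of each vertex of `G`
(`exists_isLeafRoot_of_forest`).

Labeling: two leaves of a 3-leaf root with a non-leaf root are adjacent in `G` exactly when their
parents are equal or adjacent. Sorting children by depth matters only because leaf children then
precede all other children. So, of two adjacent leaves, the parent of the earlier is the parent or
the grandparent of the later. Combined with the fact that depth-first search visits each subtree in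
one contiguous block, this gives the non-jumping condition (`dist_le_three_of_precedes`). This half
uses no assumption on `G` beyond the given root, and applied to the tree constructed above it yields
the first claim. -/

theorem inSubtree_refl (v : W) : InSubtree T x v v := by
  simp [InSubtree]

theorem inSubtree_root (w : W) : InSubtree T x x w := by
  simp [InSubtree]

theorem InSubtree.trans (hT : T.IsTree) {u v w : W} (huv : InSubtree T x u v)
    (hvw : InSubtree T x v w) : InSubtree T x u w := by
  have h₁ := hT.connected.dist_triangle (u := x) (v := u) (w := w)
  have h₂ := hT.connected.dist_triangle (u := u) (v := v) (w := w)
  unfold InSubtree at *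
  omega

theorem IsChild.inSubtree {v c : W} (h : IsChild T x v c) : InSubtree T x v c := by
  have := SimpleGraph.dist_eq_one_iff_adj.2 h.1
  unfold InSubtree
  rw [h.2, this]

theorem isChild_or_isChild_of_adj (hT : T.IsTree) {u v : W} (h : T.Adj u v) :
    IsChild T x u v ∨ IsChild T x v u := by
  rcases hT.dist_eq_dist_add_one_of_adj x h with h' | h'
  · exact Or.inr ⟨h.symm, h'⟩
  · exact Or.inl ⟨h, h'⟩

/-- Take the first step of a shortest walk from `v` to `w`; the triangle inequality forces it to
lead one level down. -/
theorem InSubtree.exists_child (hT : T.IsTree) {v w : W} (h : InSubtree T x v w) (hne : w ≠ v) :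
    ∃ c, IsChild T x v c ∧ InSubtree T x c w ∧ T.dist v w = T.dist c w + 1 := by
  obtain ⟨p, hp⟩ := hT.connected.exists_walk_length_eq_dist v w
  cases p with
  | nil => exact absurd rfl hne
  | @cons _ c _ hadj q =>
    have h₁ := SimpleGraph.dist_le q
    have h₂ := hT.connected.dist_triangle (u := x) (v := c) (w := w)
    have h₃ := hT.connected.dist_triangle (u := x) (v := v) (w := c)
    have h₄ := SimpleGraph.dist_eq_one_iff_adj.2 hadj
    rw [SimpleGraph.Walk.length_cons] at hp
    unfold InSubtree at h
    refine ⟨c, ⟨hadj, ?_⟩, ?_, ?_⟩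
    · omega
    · unfold InSubtree; omega
    · omega

/-- Shortest walks from the root to either parent extend to shortest walks, hence paths, to `c`.
Paths in a tree are unique, so their penultimate vertices agree. -/
theorem IsChild.parent_unique (hT : T.IsTree) {u v c : W} (hu : IsChild T x u c)
    (hv : IsChild T x v c) : u = v := by
  obtain ⟨p, hp⟩ := hT.connected.exists_walk_length_eq_dist x u
  obtain ⟨q, hq⟩ := hT.connected.exists_walk_length_eq_dist x v
  have hp' : (p.concat hu.1).IsPath := by
    apply SimpleGraph.Walk.isPath_of_length_eq_dist
    rw [SimpleGraph.Walk.length_concat, hp, hu.2]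
  have hq' : (q.concat hv.1).IsPath := by
    apply SimpleGraph.Walk.isPath_of_length_eq_dist
    rw [SimpleGraph.Walk.length_concat, hq, hv.2]
  have h := (hT.isAcyclic.subsingleton_path x c).elim ⟨_, hp'⟩ ⟨_, hq'⟩
  have h' := congrArg (fun r : T.Path x c => r.1.penultimate) h
  simpa using h'

theorem inSubtree_iff_reflTransGen (hT : T.IsTree) {v w : W} :
    InSubtree T x v w ↔ Relation.ReflTransGen (IsChild T x) v w := by
  constructor
  · intro h
    induction hn : T.dist v w generalizing v with
    | zero =>
      obtain rfl := hT.connected.dist_eq_zero_iff.1 hn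
      exact .refl
    | succ n ih =>
      have hne : w ≠ v := by
        rintro rfl
        simp at hn
      obtain ⟨c, hc, hcw, hd⟩ := h.exists_child hT hne
      exact .head hc (ih hcw (by omega))
  · intro h
    induction h with
    | refl => exact inSubtree_refl v
    | tail _ hc ih => exact ih.trans hT hc.inSubtree

theorem InSubtree.exists_parent (hT : T.IsTree) {v w : W} (h : InSubtree T x v w) (hne : w ≠ v) :
    ∃ u, IsChild T x u w ∧ InSubtree T x v u := by
  rcases ((inSubtree_iff_reflTransGen hT).1 h).cases_tail with h' | ⟨u, hu, huw⟩
  · exact absurd h' hne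
  · exact ⟨u, huw, (inSubtree_iff_reflTransGen hT).2 hu⟩

theorem InSubtree.eq_or_of_isChild (hT : T.IsTree) {s u w : W} (h : InSubtree T x s w)
    (hu : IsChild T x u w) : w = s ∨ InSubtree T x s u := by
  by_cases hne : w = s
  · exact Or.inl hne
  · obtain ⟨u', hu', h'⟩ := h.exists_parent hT hne
    rw [hu.parent_unique hT hu']
    exact Or.inr h'

theorem exists_parent (hT : T.IsTree) {w : W} (hne : w ≠ x) : ∃ u, IsChild T x u w := by
  obtain ⟨u, hu, -⟩ := (inSubtree_root (T := T) (x := x) w).exists_parent hT hne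
  exact ⟨u, hu⟩

/-- Parents are unique, so the ancestors of `w` form a chain. -/
theorem InSubtree.total (hT : T.IsTree) {u v w : W} (hu : InSubtree T x u w)
    (hv : InSubtree T x v w) : InSubtree T x u v ∨ InSubtree T x v u := by
  rw [inSubtree_iff_reflTransGen hT, ← Relation.reflTransGen_swap] at hu hv
  have huniq : Relator.RightUnique (Function.swap (IsChild T x)) :=
    fun _ _ _ h₁ h₂ => IsChild.parent_unique hT h₁ h₂
  rcases Relation.ReflTransGen.total_of_right_unique huniq hu hv with h | h
  · right
    rwa [inSubtree_iff_reflTransGen hT, ← Relation.reflTransGen_swap]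
  · left
    rwa [inSubtree_iff_reflTransGen hT, ← Relation.reflTransGen_swap]

theorem InSubtree.dist_le {u v : W} (h : InSubtree T x u v) : T.dist x u ≤ T.dist x v := by
  unfold InSubtree at h
  omega

theorem IsChild.not_inSubtree {v c : W} (h : IsChild T x v c) : ¬ InSubtree T x c v := by
  intro h'
  have := h'.dist_le
  have := h.2
  omega

/-- The subtrees of two children of the same vertex are disjoint. -/
theorem child_eq_of_inSubtree (hT : T.IsTree) {u s t w : W} (hs : IsChild T x u s)
    (ht : IsChild T x u t) (hsw : InSubtree T x s w) (htw : InSubtree T x t w) : s = t := by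
  rcases hsw.total hT htw with h | h
  · rcases h.eq_or_of_isChild hT ht with h' | h'
    · exact h'.symm
    · exact absurd h' hs.not_inSubtree
  · rcases h.eq_or_of_isChild hT hs with h' | h'
    · exact h'
    · exact absurd h' ht.not_inSubtree

theorem IsLeaf.not_isChild (hT : T.IsTree) {v c : W} (hv : IsLeaf T v) (hne : v ≠ x) :
    ¬ IsChild T x v c := by
  intro hc
  obtain ⟨u, hu⟩ := exists_parent hT hne
  have : u = c := hv hu.1.symm hc.1
  subst this
  have := hu.2
  have := hc.2
  omega

theorem IsLeaf.eq_of_inSubtree (hT : T.IsTree) {v w : W} (hv : IsLeaf T v) (hne : v ≠ x)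
    (h : InSubtree T x v w) : w = v := by
  by_contra hwv
  obtain ⟨c, hc, -⟩ := h.exists_child hT hwv
  exact hv.not_isChild hT hne hc

/-- A walk of length at most three between the two leaves must pass through `p` and `q`. The
condition `p ≠ v` excludes two leaves joined directly by an edge. -/
theorem dist_le_three_iff (hT : T.Connected) {u v p q : W} (huv : u ≠ v)
    (hu : ∀ w, T.Adj u w ↔ w = p) (hv : ∀ w, T.Adj v w ↔ w = q) (hpv : p ≠ v) :
    T.dist u v ≤ 3 ↔ p = q ∨ T.Adj p q := by
  have hup : T.Adj u p := (hu p).2 rfl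
  have hvq : T.Adj v q := (hv q).2 rfl
  constructor
  · intro h
    obtain ⟨r, hr⟩ := hT.exists_walk_length_eq_dist u v
    rw [← hr] at h
    clear hr
    match r with
    | .nil => exact absurd rfl huv
    | .cons h₁ .nil => exact absurd ((hu _).1 h₁).symm hpv
    | .cons h₁ (.cons h₂ .nil) =>
      exact Or.inl (((hu _).1 h₁).symm.trans ((hv _).1 h₂.symm))
    | .cons h₁ (.cons h₂ (.cons h₃ .nil)) =>
      right
      rwa [(hu _).1 h₁, (hv _).1 h₃.symm] at h₂
    | .cons h₁ (.cons h₂ (.cons h₃ (.cons h₄ r'))) =>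
      simp only [SimpleGraph.Walk.length_cons] at h
      omega
  · rintro (rfl | h)
    · exact (SimpleGraph.dist_le (.cons hup (.cons hvq.symm .nil))).trans (by simp)
    · exact (SimpleGraph.dist_le (.cons hup (.cons h (.cons hvq.symm .nil)))).trans (by simp)

theorem IsLeaf.adj_iff {w p : W} (hw : IsLeaf T w) (hp : T.Adj w p) (u : W) :
    T.Adj w u ↔ u = p :=
  ⟨fun h => hw h hp, fun h => h ▸ hp⟩

theorem IsLeaf.dist_le_three_iff (hT : T.IsTree) {u v p q : W} (huv : u ≠ v) (hu : IsLeaf T u)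
    (hv : IsLeaf T v) (hvx : v ≠ x) (hp : IsChild T x p u) (hq : IsChild T x q v) :
    T.dist u v ≤ 3 ↔ p = q ∨ T.Adj p q := by
  refine NonJumping.dist_le_three_iff hT.connected huv (hu.adj_iff hp.1.symm)
    (hv.adj_iff hq.1.symm) ?_
  rintro rfl
  exact hv.not_isChild hT hvx hp

end RootedTree

end NonJumping

namespace NonJumping

/-! ### Depth-first search -/

section DepthFirstSearch

variable {W : Type*} {T : SimpleGraph W} {x : W} {ch : W → List W}

/-- `a` and `b` belong to the subtrees rooted at two children of the same vertex, where the child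
for `a` is listed before the child for `b`. -/
def Precedes (T : SimpleGraph W) (x : W) (ch : W → List W) (a b : W) : Prop :=
  ∃ u s t, [s, t].Sublist (ch u) ∧ InSubtree T x s a ∧ InSubtree T x t b

theorem not_pair_sublist_swap {α : Type*} {l : List α} (hl : l.Nodup) {a b : α}
    (hab : [a, b].Sublist l) : ¬ [b, a].Sublist l := by
  intro hba
  induction l with
  | nil => simp at hab
  | cons c l ih =>
    rw [List.nodup_cons] at hl
    rw [List.sublist_cons_iff] at hab hba
    have key : ∀ {p q : α}, (∃ r, [p, q] = c :: r ∧ r.Sublist l) → p = c ∧ q ∈ l := by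
      rintro p q ⟨r, hr, hrl⟩
      simp only [List.cons.injEq] at hr
      exact ⟨hr.1, hrl.subset (by simp [← hr.2])⟩
    rcases hab with h₁ | h₁
    · rcases hba with h₂ | h₂
      · exact ih hl.2 h₁ h₂
      · obtain ⟨rfl, -⟩ := key h₂
        exact hl.1 (h₁.subset (by simp))
    · obtain ⟨rfl, hb⟩ := key h₁
      rcases hba with h₂ | h₂
      · exact hl.1 (h₂.subset (by simp))
      · obtain ⟨rfl, -⟩ := key h₂
        exact hl.1 hb

theorem pair_sublist_or_of_mem {α : Type*} {l : List α} {a b : α} (ha : a ∈ l) (hb : b ∈ l)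
    (hne : a ≠ b) : [a, b].Sublist l ∨ [b, a].Sublist l := by
  induction l with
  | nil => simp at ha
  | cons c l ih =>
    rcases List.mem_cons.1 ha with rfl | ha'
    · rcases List.mem_cons.1 hb with rfl | hb'
      · exact absurd rfl hne
      · exact Or.inl ((List.singleton_sublist.2 hb').cons_cons _)
    · rcases List.mem_cons.1 hb with rfl | hb'
      · exact Or.inr ((List.singleton_sublist.2 ha').cons_cons _)
      · exact (ih ha' hb').imp (fun h => h.cons _) (fun h => h.cons _)

theorem dist_le_subtreeDepth [Fintype W] {v w : W} (h : InSubtree T x v w) :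
    T.dist v w ≤ subtreeDepth T x v := by
  classical
  unfold subtreeDepth
  exact Finset.le_sup (f := fun w => T.dist v w) (by simpa using h)

theorem IsLeaf.subtreeDepth_eq_zero [Fintype W] (hT : T.IsTree) {v : W} (hv : IsLeaf T v)
    (hne : v ≠ x) : subtreeDepth T x v = 0 := by
  classical
  unfold subtreeDepth
  refine Nat.le_zero.1 (Finset.sup_le fun w hw => ?_)
  have hw' : InSubtree T x v w := by simpa using hw
  rw [hv.eq_of_inSubtree hT hne hw']
  simp

theorem exists_isDepthSorted [Fintype W] (T : SimpleGraph W) (x : W) :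
    ∃ ch : W → List W, IsDepthSorted T x ch := by
  classical
  let r : W → W → Prop := fun a b => subtreeDepth T x a ≤ subtreeDepth T x b
  have : Std.Total r := ⟨fun a b => Nat.le_total _ _⟩
  have : IsTrans W r := ⟨fun a b c => Nat.le_trans⟩
  let l : W → List W := fun v => (Finset.univ.filter (IsChild T x v)).toList
  refine ⟨fun v => (l v).insertionSort r, fun v => ?_, fun v c => ?_, fun v => ?_⟩
  · exact (List.perm_insertionSort r _).nodup_iff.2 (Finset.nodup_toList _)
  · rw [(List.perm_insertionSort r _).mem_iff]
    simp [l]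
  · exact List.pairwise_insertionSort r _

section Sorted

variable [Fintype W]

theorem IsDepthSorted.of_sublist (hch : IsDepthSorted T x ch) {u s t : W}
    (h : [s, t].Sublist (ch u)) :
    IsChild T x u s ∧ IsChild T x u t ∧ s ≠ t ∧ subtreeDepth T x s ≤ subtreeDepth T x t := by
  refine ⟨(hch.mem_iff _ _).1 (h.subset (by simp)), (hch.mem_iff _ _).1 (h.subset (by simp)),
    ?_, ?_⟩
  · simpa using (hch.nodup u).sublist h
  · simpa using (hch.sorted u).sublist h

/-- The vertex at which `a` and `b` branch apart is unique: of two comparable candidates, the lower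
lies under a single child of the upper, and then `a` and `b` would not branch at the upper. At that
vertex the order of the two children is fixed. -/
theorem Precedes.asymm (hT : T.IsTree) (hch : IsDepthSorted T x ch) {a b : W}
    (hab : Precedes T x ch a b) : ¬ Precedes T x ch b a := by
  rintro ⟨v, t', s', hts', hb', ha'⟩
  obtain ⟨u, s, t, hst, ha, hb⟩ := hab
  obtain ⟨hs, ht, hne, -⟩ := hch.of_sublist hst
  obtain ⟨ht', hs', hne', -⟩ := hch.of_sublist hts'
  by_cases huv : u = v
  · subst huv
    obtain rfl := child_eq_of_inSubtree hT hs hs' ha ha'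
    obtain rfl := child_eq_of_inSubtree hT ht ht' hb hb'
    exact not_pair_sublist_swap (hch.nodup u) hst hts'
  · have hau := hs.inSubtree.trans hT ha
    have hbu := ht.inSubtree.trans hT hb
    have hav := hs'.inSubtree.trans hT ha'
    have hbv := ht'.inSubtree.trans hT hb'
    rcases hau.total hT hav with h | h
    · obtain ⟨c, hc, hcv, -⟩ := h.exists_child hT (Ne.symm huv)
      exact hne ((child_eq_of_inSubtree hT hs hc ha (hcv.trans hT hav)).trans
        (child_eq_of_inSubtree hT ht hc hb (hcv.trans hT hbv)).symm)
    · obtain ⟨c, hc, hcv, -⟩ := h.exists_child hT huv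
      exact hne' ((child_eq_of_inSubtree hT ht' hc hb' (hcv.trans hT hbu)).trans
        (child_eq_of_inSubtree hT hs' hc ha' (hcv.trans hT hau)).symm)

theorem Precedes.ne (hT : T.IsTree) (hch : IsDepthSorted T x ch) {a b : W}
    (hab : Precedes T x ch a b) : a ≠ b := by
  rintro rfl
  exact hab.asymm hT hch hab

theorem IsDepthSorted.sublist_or (hch : IsDepthSorted T x ch) {u s t : W} (hs : IsChild T x u s)
    (ht : IsChild T x u t) (hne : s ≠ t) :
    [s, t].Sublist (ch u) ∨ [t, s].Sublist (ch u) := by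
  exact pair_sublist_or_of_mem ((hch.mem_iff _ _).2 hs) ((hch.mem_iff _ _).2 ht) hne

/-- Before a leaf, only leaves are visited among its siblings and their descendants. -/
theorem Precedes.eq_of_isLeaf_child (hT : T.IsTree) (hch : IsDepthSorted T x ch) {a b u : W}
    (hab : Precedes T x ch a b) (hb : IsLeaf T b) (hbx : b ≠ x) (hub : IsChild T x u b)
    (hua : InSubtree T x u a) : IsChild T x u a := by
  obtain ⟨v, s, t, hst, hsa, htb⟩ := hab
  obtain ⟨hs, ht, hne, hle⟩ := hch.of_sublist hst
  rcases htb.eq_or_of_isChild hT hub with rfl | h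
  · obtain rfl := ht.parent_unique hT hub
    -- A leaf has subtree depth zero, so the earlier sibling subtree has depth zero as well and
    -- consists of its root alone.
    rw [hb.subtreeDepth_eq_zero hT hbx] at hle
    have := dist_le_subtreeDepth hsa
    have h0 : T.dist s a = 0 := by omega
    obtain rfl := hT.connected.dist_eq_zero_iff.1 h0
    exact hs
  · exact absurd (child_eq_of_inSubtree hT hs ht hsa (h.trans hT hua)) hne

/-- Two leaves at distance at most three: the parent of the first one is the parent or the
grandparent of the second one. -/
theorem Precedes.parent_eq_or_isChild (hT : T.IsTree) (hch : IsDepthSorted T x ch)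
    {a b p q : W} (hab : Precedes T x ch a b) (ha : IsLeaf T a)
    (hb : IsLeaf T b) (hbx : b ≠ x) (hp : IsChild T x p a) (hq : IsChild T x q b)
    (hd : T.dist a b ≤ 3) : p = q ∨ IsChild T x p q := by
  rw [IsLeaf.dist_le_three_iff hT (hab.ne hT hch) ha hb hbx hp hq] at hd
  rcases hd with hd | hd
  · exact Or.inl hd
  rcases isChild_or_isChild_of_adj (x := x) hT hd with h | h
  · exact Or.inr h
  · have := hab.eq_of_isLeaf_child hT hch hb hbx hq (h.inSubtree.trans hT hp.inSubtree)
    exact Or.inl (hp.parent_unique hT this)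

/-- The parent `p` of `a` has `c` below it, and since `b` is visited between them, `b` lies below
`p` too. If the parents of `b` and `c` were neither equal nor adjacent, `b` and `c` would sit under
different children of `p`, with `d` in the same child subtree as `b`. That block would contain `b`
and `d` but not `c`, which is visited between them. -/
theorem dist_le_three_of_precedes (hT : T.IsTree) (hx : ¬ IsLeaf T x)
    (hch : IsDepthSorted T x ch) {a b c d : W} (ha : IsLeaf T a) (hb : IsLeaf T b)
    (hc : IsLeaf T c) (hd : IsLeaf T d) (hab : Precedes T x ch a b) (hbc : Precedes T x ch b c)
    (hcd : Precedes T x ch c d) (hac : Precedes T x ch a c) (hbd : Precedes T x ch b d)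
    (hdac : T.dist a c ≤ 3) (hdbd : T.dist b d ≤ 3) : T.dist b c ≤ 3 := by
  have hne : ∀ {w : W}, IsLeaf T w → w ≠ x := fun hw h => hx (h ▸ hw)
  obtain ⟨p, hp⟩ := exists_parent hT (hne ha)
  obtain ⟨q, hq⟩ := exists_parent hT (hne hb)
  obtain ⟨r, hr⟩ := exists_parent hT (hne hc)
  obtain ⟨z, hz⟩ := exists_parent hT (hne hd)
  have hpr := hac.parent_eq_or_isChild hT hch ha hc (hne hc) hp hr hdac
  have hqz := hbd.parent_eq_or_isChild hT hch hb hd (hne hd) hq hz hdbd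
  rw [IsLeaf.dist_le_three_iff hT (hbc.ne hT hch) hb hc (hne hc) hq hr]
  have hqd : InSubtree T x q d := by
    rcases hqz with rfl | h
    · exact hz.inSubtree
    · exact h.inSubtree.trans hT hz.inSubtree
  have hpc : InSubtree T x p c := by
    rcases hpr with rfl | h
    · exact hr.inSubtree
    · exact h.inSubtree.trans hT hr.inSubtree
  -- `b` is in the subtree of a sibling of `a`
  obtain ⟨t, ht, htb⟩ : ∃ t, IsChild T x p t ∧ InSubtree T x t b := by
    obtain ⟨v, s, t, hst, hsa, htb⟩ := id hab
    obtain ⟨hs, ht, -, -⟩ := hch.of_sublist hst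
    rcases hsa.eq_or_of_isChild hT hp with rfl | h
    · obtain rfl := hs.parent_unique hT hp
      exact ⟨t, ht, htb⟩
    · exact absurd ⟨v, s, t, hst, h.trans hT hpc, htb⟩ (hbc.asymm hT hch)
  rcases hpr with rfl | hpr
  · have := hbc.eq_of_isLeaf_child hT hch hc (hne hc) hr (ht.inSubtree.trans hT htb)
    exact Or.inl (hq.parent_unique hT this)
  · rcases htb.eq_or_of_isChild hT hq with rfl | htq
    · obtain rfl := ht.parent_unique hT hq
      exact Or.inr hpr.1
    · by_cases htr : t = r
      · subst htr
        have := hbc.eq_of_isLeaf_child hT hch hc (hne hc) hr htb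
        exact Or.inl (hq.parent_unique hT this)
      · rcases hch.sublist_or ht hpr htr with h | h
        · exact absurd ⟨p, t, r, h, htq.trans hT hqd, hr.inSubtree⟩ (hcd.asymm hT hch)
        · exact absurd ⟨p, r, t, h, hr.inSubtree, htb⟩ (hbc.asymm hT hch)

theorem dfsLeaves_of_mem (hT : T.IsTree) (hch : IsDepthSorted T x ch) {k : ℕ} {v w : W}
    (h : w ∈ dfsLeaves T ch k v) : IsLeaf T w ∧ InSubtree T x v w := by
  induction k generalizing v with
  | zero => simp [dfsLeaves] at h
  | succ k ih =>
    rw [dfsLeaves] at h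
    split_ifs at h with hv
    · obtain rfl := List.mem_singleton.1 h
      exact ⟨hv, inSubtree_refl _⟩
    · obtain ⟨c, hc, hw⟩ := List.mem_flatMap.1 h
      exact ⟨(ih hw).1, ((hch.mem_iff _ _).1 hc).inSubtree.trans hT (ih hw).2⟩

theorem mem_dfsLeaves (hT : T.IsTree) (hx : ¬ IsLeaf T x) (hch : IsDepthSorted T x ch) {k : ℕ}
    {v w : W} (hw : IsLeaf T w) (hvw : InSubtree T x v w) (hk : T.dist v w < k) :
    w ∈ dfsLeaves T ch k v := by
  induction k generalizing v with
  | zero => simp at hk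
  | succ k ih =>
    rw [dfsLeaves]
    split_ifs with hv
    · exact List.mem_singleton.2 (hv.eq_of_inSubtree hT (fun h : v = x => hx (h ▸ hv)) hvw)
    · have hne : w ≠ v := by
        rintro rfl
        exact hv hw
      obtain ⟨c, hc, hcw, hd⟩ := hvw.exists_child hT hne
      exact List.mem_flatMap.2 ⟨c, (hch.mem_iff _ _).2 hc, ih hcw (by omega)⟩

theorem dfsLeaves_pairwise (hT : T.IsTree) (hch : IsDepthSorted T x ch) (k : ℕ) (v : W) :
    (dfsLeaves T ch k v).Pairwise (Precedes T x ch) := by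
  induction k generalizing v with
  | zero => simp [dfsLeaves]
  | succ k ih =>
    rw [dfsLeaves]
    split_ifs with hv
    · simp
    · rw [List.pairwise_flatMap]
      refine ⟨fun c _ => ih c, ?_⟩
      rw [List.pairwise_iff_forall_sublist]
      intro s t hst a ha b hb
      exact ⟨v, s, t, hst, (dfsLeaves_of_mem hT hch ha).2, (dfsLeaves_of_mem hT hch hb).2⟩

theorem dist_lt_card (hT : T.IsTree) (v w : W) : T.dist v w < Fintype.card W := by
  classical
  obtain ⟨p, hp, hl⟩ := hT.connected.exists_path_of_dist v w
  rw [← hl]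
  exact hp.length_lt

theorem mem_dfsLeafOrder (hT : T.IsTree) (hx : ¬ IsLeaf T x) (hch : IsDepthSorted T x ch)
    (w : W) : w ∈ dfsLeafOrder T x ch ↔ IsLeaf T w :=
  ⟨fun h => (dfsLeaves_of_mem hT hch h).1,
    fun h => mem_dfsLeaves hT hx hch h (inSubtree_root w) (dist_lt_card hT x w)⟩

/-- The leaf order of a depth-first search that visits shallow subtrees first is a non-jumping
labeling of a graph of which the tree is a 3-leaf root. -/
theorem exists_isNonJumpingLabeling_dfs {V : Type*} [Fintype V] {G : SimpleGraph V}
    {φ : V ≃ {w : W // IsLeaf T w}} (hφ : IsLeafRoot 3 G T φ) (hx : ¬ IsLeaf T x)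
    (hch : IsDepthSorted T x ch) :
    ∃ γ : Fin (Fintype.card V) ≃ V,
      List.ofFn (fun i => (φ (γ i) : W)) = dfsLeafOrder T x ch ∧ IsNonJumpingLabeling G γ := by
  classical
  have hT := hφ.isTree
  set L := dfsLeafOrder T x ch with hL
  have hpw : L.Pairwise (Precedes T x ch) := dfsLeaves_pairwise hT hch _ x
  have hnd : L.Nodup := hpw.imp fun h => h.ne hT hch
  have hmem : ∀ w, w ∈ L ↔ IsLeaf T w := mem_dfsLeafOrder hT hx hch
  let e : Fin L.length ≃ V :=
    ((List.Nodup.getEquiv L hnd).trans (Equiv.subtypeEquivRight hmem)).trans φ.symm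
  have he : ∀ i, (φ (e i) : W) = L.get i := by
    intro i
    simp [e]
  have hcard : Fintype.card V = L.length := by
    simpa using (Fintype.card_congr e).symm
  let γ : Fin (Fintype.card V) ≃ V := (finCongr hcard).trans e
  have hγ : ∀ i, (φ (γ i) : W) = L.get (finCongr hcard i) := fun i => he _
  refine ⟨γ, ?_, ?_⟩
  · apply List.ext_getElem
    · simpa using hcard
    · intro i h₁ h₂
      simp [hγ]
  · have hlt : ∀ {i j : Fin (Fintype.card V)}, i < j →
        Precedes T x ch (φ (γ i)) (φ (γ j)) := by
      intro i j hij
      rw [hγ, hγ]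
      exact List.pairwise_iff_get.1 hpw _ _ hij
    intro i j k l hij hjk hkl hik hjl
    rw [hφ.adj_iff _ _ hik.ne] at hik
    rw [hφ.adj_iff _ _ hjl.ne] at hjl
    rw [hφ.adj_iff _ _ (γ.injective.ne hjk.ne)]
    exact dist_le_three_of_precedes hT hx hch (φ (γ i)).2 (φ (γ j)).2 (φ (γ k)).2 (φ (γ l)).2
      (hlt hij) (hlt hjk) (hlt hkl) (hlt (hij.trans hjk)) (hlt (hjk.trans hkl)) hik hjl

end Sorted

end DepthFirstSearch

end NonJumping

namespace NonJumping

/-! ### Twins in chordal graphs without bull, dart and gem -/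

section Twins

variable {V : Type*} {G : SimpleGraph V}

theorem IsFree.bull (h : IsFree bull G) {a b c x y : V} (hab : G.Adj a b) (hac : G.Adj a c)
    (hbc : G.Adj b c) (hax : G.Adj a x) (hby : G.Adj b y) (hay : ¬ G.Adj a y)
    (hbx : ¬ G.Adj b x) (hcx : ¬ G.Adj c x) (hcy : ¬ G.Adj c y) (hxy : ¬ G.Adj x y) : False := by
  have hinj : Function.Injective ![a, b, c, x, y] := by
    intro i j hij
    fin_cases i <;> fin_cases j <;> simp at hij ⊢ <;> subst hij <;> simp_all [G.adj_comm]
  refine h ⟨⟨⟨_, hinj⟩, ?_⟩⟩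
  intro i j
  fin_cases i <;> fin_cases j <;> simp [NonJumping.bull, *, G.adj_comm]

/-- Unlike in the bull and the gem, distinctness does not follow entirely from the adjacencies: `c`
and `d` have the same neighbours in the dart, so `c ≠ d` is required. -/
theorem IsFree.dart (h : IsFree dart G) {a b c d x : V} (hab : G.Adj a b) (hac : G.Adj a c)
    (had : G.Adj a d) (hbc : G.Adj b c) (hbd : G.Adj b d) (hax : G.Adj a x) (hcd : ¬ G.Adj c d)
    (hne : c ≠ d) (hbx : ¬ G.Adj b x) (hcx : ¬ G.Adj c x) (hdx : ¬ G.Adj d x) : False := by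
  have hinj : Function.Injective ![a, b, c, d, x] := by
    intro i j hij
    fin_cases i <;> fin_cases j <;> simp at hij ⊢ <;> subst hij <;> simp_all [G.adj_comm]
  refine h ⟨⟨⟨_, hinj⟩, ?_⟩⟩
  intro i j
  fin_cases i <;> fin_cases j <;> simp [NonJumping.dart, *, G.adj_comm]

theorem IsFree.gem (h : IsFree gem G) {a b c d e : V} (hab : G.Adj a b) (hbc : G.Adj b c)
    (hcd : G.Adj c d) (hae : G.Adj a e) (hbe : G.Adj b e) (hce : G.Adj c e) (hde : G.Adj d e)
    (hac : ¬ G.Adj a c) (hbd : ¬ G.Adj b d) (had : ¬ G.Adj a d) : False := by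
  have hinj : Function.Injective ![a, b, c, d, e] := by
    intro i j hij
    fin_cases i <;> fin_cases j <;> simp at hij ⊢ <;> subst hij <;> simp_all [G.adj_comm]
  refine h ⟨⟨⟨_, hinj⟩, ?_⟩⟩
  intro i j
  fin_cases i <;> fin_cases j <;> simp [NonJumping.gem, *, G.adj_comm]

/-- Any two neighbours of a vertex that come before it are adjacent. -/
def EarlierNeighborsClique (G : SimpleGraph V) (f : V → ℕ) : Prop :=
  ∀ u v w, G.Adj v u → G.Adj v w → f u < f v → f w < f v → u ≠ w → G.Adj u w

theorem IsChordal.exists_earlierNeighborsClique [Fintype V] (h : IsChordal G) :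
    ∃ f : V → ℕ, Function.Injective f ∧ EarlierNeighborsClique G f := by
  obtain ⟨γ, hγ⟩ := h
  refine ⟨fun v => (γ.symm v : ℕ), fun u v huv => γ.symm.injective (Fin.ext huv), ?_⟩
  intro u v w hu hw huv hwv huw
  have hmem : ∀ z, (γ.symm z : ℕ) < γ.symm v → z ∈ γ '' Set.Iic (γ.symm v) := fun z hz =>
    ⟨γ.symm z, Fin.le_def.2 hz.le, by simp⟩
  have := hγ (γ.symm v) (x := ⟨u, hmem u huv⟩) (Or.inr (by simpa using hu))
    (y := ⟨w, hmem w hwv⟩) (Or.inr (by simpa using hw)) (by simpa using huw)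
  simpa using this

/-- The latest vertex of an induced 4-cycle would have two nonadjacent earlier neighbours. -/
theorem EarlierNeighborsClique.not_induced_square {f : V → ℕ} (hf : Function.Injective f)
    (h : EarlierNeighborsClique G f) {a b c d : V} (hab : G.Adj a b) (hbc : G.Adj b c)
    (hcd : G.Adj c d) (hda : G.Adj d a) (hac : ¬ G.Adj a c) (hbd : ¬ G.Adj b d) (hac' : a ≠ c)
    (hbd' : b ≠ d) : False := by
  have h₁ := hf.ne hab.ne
  have h₂ := hf.ne hbc.ne
  have h₃ := hf.ne hcd.ne
  have h₄ := hf.ne hda.ne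
  have k₁ := h b a d hab hda.symm
  have k₂ := h a b c hab.symm hbc
  have k₃ := h b c d hbc.symm hcd
  have k₄ := h a d c hda hcd.symm
  have k₁' : ¬ (f b < f a ∧ f d < f a) := fun hh => hbd (k₁ hh.1 hh.2 hbd')
  have k₂' : ¬ (f a < f b ∧ f c < f b) := fun hh => hac (k₂ hh.1 hh.2 hac')
  have k₃' : ¬ (f b < f c ∧ f d < f c) := fun hh => hbd (k₃ hh.1 hh.2 hbd')
  have k₄' : ¬ (f a < f d ∧ f c < f d) := fun hh => hac (k₄ hh.1 hh.2 hac')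
  omega

/-- Among `a`, `b`, `c`, the vertex `x` is adjacent either only to `a` or only to `b` and `c`. -/
def Splits (G : SimpleGraph V) (x a b c : V) : Prop :=
  x ≠ a ∧ x ≠ b ∧ x ≠ c ∧
    ((G.Adj a x ∧ ¬ G.Adj b x ∧ ¬ G.Adj c x) ∨ (¬ G.Adj a x ∧ G.Adj b x ∧ G.Adj c x))

theorem Splits.swap {x a b c : V} (h : Splits G x a b c) : Splits G x a c b := by
  unfold Splits at *
  tauto

/-- The closed neighbourhood of a vertex. -/
def closedNeighborSet (G : SimpleGraph V) (v : V) : Set V :=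
  insert v (G.neighborSet v)

theorem mem_closedNeighborSet {v w : V} : w ∈ closedNeighborSet G v ↔ w = v ∨ G.Adj v w :=
  Iff.rfl

/-- A vertex telling `a` and `b` apart is adjacent to exactly one of them; its adjacency to `c`
decides which of the two it singles out. -/
theorem exists_splits {a b c : V} (hab : G.Adj a b) (hac : G.Adj a c) (hbc : G.Adj b c)
    (h : closedNeighborSet G a ≠ closedNeighborSet G b) :
    ∃ x, Splits G x a b c ∨ Splits G x b a c := by
  by_contra! hcon
  refine h (Set.ext fun x => ?_)
  have hx := hcon x
  simp only [mem_closedNeighborSet, Splits] at *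
  by_cases h₁ : x = a
  · subst h₁
    simp [hab.symm]
  by_cases h₂ : x = b
  · subst h₂
    simp [hab]
  by_cases h₃ : x = c
  · subst h₃
    simp [hac, hbc]
  tauto

/-- There are two types for `x`, two for `y`, and `x`, `y` are adjacent or not. The eight cases give
two induced 4-cycles, one bull, two darts and three gems. -/
theorem false_of_splits {f : V → ℕ} (hf : Function.Injective f) (h : EarlierNeighborsClique G f)
    (hbull : IsFree bull G) (hdart : IsFree dart G) (hgem : IsFree gem G) {a b c x y : V}
    (hab : G.Adj a b) (hac : G.Adj a c) (hbc : G.Adj b c) (hx : Splits G x a b c)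
    (hy : Splits G y b a c) : False := by
  obtain ⟨hxa, hxb, hxc, hx⟩ := hx
  obtain ⟨hyb, hya, hyc, hy⟩ := hy
  rcases hx with ⟨h₁, h₂, h₃⟩ | ⟨h₁, h₂, h₃⟩ <;> rcases hy with ⟨k₁, k₂, k₃⟩ | ⟨k₁, k₂, k₃⟩ <;>
    by_cases hxy : G.Adj x y
  · exact h.not_induced_square hf hab k₁ hxy.symm h₁.symm k₂ h₂ hya.symm hxb.symm
  · exact hbull.bull hab hac hbc h₁ k₁ k₂ h₂ h₃ k₃ hxy
  · exact hgem.gem hbc k₃ hxy.symm hab.symm hac.symm k₂.symm h₁.symm k₁ h₃ h₂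
  · exact hdart.dart hac hab k₂ hbc.symm k₃ h₁ k₁ hyb.symm h₃ h₂ (fun hh => hxy hh.symm)
  · exact hgem.gem hac h₃ hxy hab hbc.symm h₂.symm k₁.symm h₁ k₃ k₂
  · exact hdart.dart hbc hab.symm h₂ hac.symm h₃ k₁ h₁ hxa.symm k₃ k₂ hxy
  · exact h.not_induced_square hf hab h₂ hxy k₂.symm h₁ k₁ hxa.symm hyb.symm
  · exact hgem.gem h₂.symm hab.symm k₂ h₃.symm hbc hac k₃.symm (fun hh => h₁ hh.symm) k₁ hxy

/-- Two of the vertices of any triangle are twins. -/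
theorem false_of_triangle_without_twins {f : V → ℕ} (hf : Function.Injective f)
    (h : EarlierNeighborsClique G f) (hbull : IsFree bull G) (hdart : IsFree dart G)
    (hgem : IsFree gem G) {a b c : V} (hab : G.Adj a b) (hac : G.Adj a c) (hbc : G.Adj b c)
    (hnab : closedNeighborSet G a ≠ closedNeighborSet G b)
    (hnac : closedNeighborSet G a ≠ closedNeighborSet G c)
    (hnbc : closedNeighborSet G b ≠ closedNeighborSet G c) : False := by
  -- Some vertex singles out `a` or `b`. Applying the same to the pair that omits the vertex singled
  -- out gives a second, different one.
  obtain ⟨x, hx | hx⟩ := exists_splits hab hac hbc hnab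
  · obtain ⟨y, hy | hy⟩ := exists_splits hbc hab.symm hac.symm hnbc
    · exact false_of_splits hf h hbull hdart hgem hab hac hbc hx hy.swap
    · exact false_of_splits hf h hbull hdart hgem hac hab hbc.symm hx.swap hy.swap
  · obtain ⟨y, hy | hy⟩ := exists_splits hac hab hbc.symm hnac
    · exact false_of_splits hf h hbull hdart hgem hab.symm hbc hac hx hy.swap
    · exact false_of_splits hf h hbull hdart hgem hbc hab.symm hac.symm hx.swap hy.swap

/-- Distinct twins are adjacent; between different twin classes, replace one endpoint at a time by
its twin. -/
theorem adj_iff_of_closedNeighborSet_eq {u v u' v' : V} (huv : u ≠ v)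
    (hu : closedNeighborSet G u' = closedNeighborSet G u)
    (hv : closedNeighborSet G v' = closedNeighborSet G v)
    (hiff : closedNeighborSet G u = closedNeighborSet G v ↔ u' = v') :
    G.Adj u v ↔ u' = v' ∨ G.Adj u' v' := by
  have hu' : ∀ w, (w = u' ∨ G.Adj u' w) ↔ (w = u ∨ G.Adj u w) := fun w => by
    rw [← mem_closedNeighborSet, ← mem_closedNeighborSet, hu]
  have hv' : ∀ w, (w = v' ∨ G.Adj v' w) ↔ (w = v ∨ G.Adj v w) := fun w => by
    rw [← mem_closedNeighborSet, ← mem_closedNeighborSet, hv]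
  by_cases heq : u' = v'
  · subst heq
    have := (hu' v).symm.trans (hv' v)
    simp [huv.symm] at this
    simp [this]
  · have hne : ¬ closedNeighborSet G u = closedNeighborSet G v := fun hh => heq (hiff.1 hh)
    have h₁ : v ≠ u' := by
      rintro rfl
      exact hne hu.symm
    have h₂ := hu' v
    have h₃ := hv' u'
    simp only [h₁, huv.symm, false_or] at h₂
    simp only [heq, h₁.symm, false_or] at h₃
    rw [← h₂, G.adj_comm u' v, ← h₃, G.adj_comm v' u']
    simp [heq]

end Twins

end NonJumping

namespace NonJumping

universe u

/-! ### Trees given by parents -/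

section ParentGraph

variable {W : Type*}

/-- The graph in which every vertex except `r` is joined to its parent. -/
def parentGraph (r : W) (par : W → W) : SimpleGraph W :=
  SimpleGraph.fromRel fun v w => v ≠ r ∧ par v = w

variable {r : W} {par : W → W} {rank : W → ℕ}

theorem parentGraph_adj_par (hrank : ∀ w, w ≠ r → rank (par w) < rank w) {w : W} (hw : w ≠ r) :
    (parentGraph r par).Adj w (par w) := by
  rw [parentGraph, SimpleGraph.fromRel_adj]
  refine ⟨fun h => ?_, Or.inl ⟨hw, rfl⟩⟩
  have := hrank w hw
  rw [← h] at this
  exact lt_irrefl _ this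

theorem parentGraph_eq_of_adj (hrank : ∀ w, w ≠ r → rank (par w) < rank w) {v w : W}
    (h : (parentGraph r par).Adj v w) (hle : rank w ≤ rank v) : par v = w := by
  rw [parentGraph, SimpleGraph.fromRel_adj] at h
  rcases h.2 with ⟨-, h⟩ | ⟨hw, rfl⟩
  · exact h
  · have := hrank w hw
    omega

/-- Following parents lowers the rank until `r` is reached, so the graph is connected. On a cycle,
both neighbours of a vertex of maximal rank would be its parent. -/
theorem parentGraph_isTree (hrank : ∀ w, w ≠ r → rank (par w) < rank w) :
    (parentGraph r par).IsTree := by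
  classical
  have hreach : ∀ n w, rank w = n → (parentGraph r par).Reachable w r := by
    intro n
    induction n using Nat.strong_induction_on with
    | _ n ih =>
      rintro w rfl
      by_cases hw : w = r
      · rw [hw]
      · exact (parentGraph_adj_par hrank hw).reachable.trans (ih _ (hrank w hw) _ rfl)
  have : Nonempty W := ⟨r⟩
  refine ⟨⟨fun v w => (hreach _ v rfl).trans (hreach _ w rfl).symm⟩, ?_⟩
  intro v c hc
  obtain ⟨m, hm, hmax⟩ := c.support.toFinset.exists_max_image rank
    ⟨v, by simp⟩
  have hm' : m ∈ c.support := by simpa using hm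
  have hcyc := hc.rotate hm'
  have hle : ∀ w ∈ (c.rotate m hm').support, rank w ≤ rank m := fun w hw =>
    hmax w (by simpa [SimpleGraph.Walk.mem_support_rotate_iff] using hw)
  have h₁ := parentGraph_eq_of_adj hrank (SimpleGraph.Walk.adj_snd hcyc.not_nil)
    (hle _ (SimpleGraph.Walk.getVert_mem_support _ _))
  have h₂ := parentGraph_eq_of_adj hrank (SimpleGraph.Walk.adj_penultimate hcyc.not_nil).symm
    (hle _ (SimpleGraph.Walk.getVert_mem_support _ _))
  exact hcyc.snd_ne_penultimate (h₁.symm.trans h₂)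

end ParentGraph

/-! ### The leaf root -/

section LeafRoot

variable {V : Type u} {G : SimpleGraph V}

theorem exists_isLeafRoot_of_forest [Fintype V] [Nontrivial V] {f : V → ℕ}
    (hf : Function.Injective f) {r : V → V} (hr : ∀ v, r (r v) = r v)
    (huniq : ∀ p u w, r p = p → r u = u → r w = w → G.Adj p u → G.Adj p w →
      f u < f p → f w < f p → u = w)
    (hadj : ∀ u v, u ≠ v → (G.Adj u v ↔ r u = r v ∨ G.Adj (r u) (r v))) :
    ∃ (W : Type u) (_ : Fintype W) (T : SimpleGraph W) (φ : V ≃ {w : W // IsLeaf T w}),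
      IsLeafRoot 3 G T φ ∧ ∃ x, ¬ IsLeaf T x := by
  classical
  let R := {v : V // r v = v}
  let v₀ : V := Classical.arbitrary V
  obtain ⟨q₀, -, hq₀⟩ := (Finset.univ : Finset R).exists_min_image (fun q => f q)
    ⟨⟨r v₀, hr v₀⟩, Finset.mem_univ _⟩
  have hq₀ : ∀ q : R, q ≠ q₀ → f q₀ < f q := fun q hq =>
    lt_of_le_of_ne (hq₀ q (Finset.mem_univ _)) fun h => hq (Subtype.ext (hf h)).symm
  -- representatives without an earlier neighbour are joined to the first one by a path
  let Z := {q : R // q ≠ q₀ ∧ ∀ u : R, G.Adj q u → ¬ f u < f q}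
  have hpre : ∀ q : R, ∃ s : R ⊕ Z, q ≠ q₀ →
      (∃ u : R, s = Sum.inl u ∧ G.Adj q u ∧ f u < f q) ∨ (∃ z : Z, s = Sum.inr z ∧ z.1 = q) := by
    intro q
    -- At the root `q₀` the value is arbitrary, as its parent is never used.
    by_cases h₀ : q = q₀
    · exact ⟨Sum.inl q, fun h => absurd h₀ h⟩
    by_cases h : ∀ u : R, G.Adj q u → ¬ f u < f q
    · exact ⟨Sum.inr ⟨q, h₀, h⟩, fun _ => Or.inr ⟨_, rfl, rfl⟩⟩
    · push Not at h
      obtain ⟨u, hu⟩ := h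
      exact ⟨Sum.inl u, fun _ => Or.inl ⟨u, rfl, hu⟩⟩
  choose pre hpre using hpre
  let rep : V → R := fun v => ⟨r v, hr v⟩
  have hrep : ∀ q : R, rep q = q := fun q => Subtype.ext q.2
  let W := V ⊕ (R ⊕ Z)
  let leaf : V → W := Sum.inl
  let node : R → W := fun q => Sum.inr (Sum.inl q)
  let link : Z → W := fun z => Sum.inr (Sum.inr z)
  -- A link between `q₀` and the first vertex of another component puts their leaves at distance
  -- four, so no adjacency is created.
  let par : W → W := Sum.elim (fun v => node (rep v))
    (Sum.elim (fun q => Sum.inr (pre q)) (fun _ => node q₀))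
  -- The factor 3 makes room for a link just below its representative and a leaf just above, while
  -- `f q₀` is minimal, so every parent has smaller rank.
  let rank : W → ℕ := Sum.elim (fun v => 3 * f (r v) + 2)
    (Sum.elim (fun q => 3 * f q + 1) (fun z => 3 * f z.1))
  have hrank : ∀ w, w ≠ node q₀ → rank (par w) < rank w := by
    rintro (v | q | z) hw
    · exact Nat.lt_succ_self _
    · have hq : q ≠ q₀ := fun h => hw (by rw [h])
      rcases hpre q hq with ⟨u, hu, -, hlt⟩ | ⟨z, hz, rfl⟩
      · change rank (Sum.inr (pre q)) < 3 * f q + 1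
        rw [hu]
        change 3 * f u + 1 < 3 * f q + 1
        omega
      · change rank (Sum.inr (pre z.1)) < 3 * f z.1 + 1
        rw [hz]
        exact Nat.lt_succ_self _
    · have := hq₀ z.1 z.2.1
      change 3 * f q₀ + 1 < 3 * f z.1
      omega
  let T := parentGraph (node q₀) par
  have hT : T.IsTree := parentGraph_isTree hrank
  have hTpar : ∀ {w : W}, w ≠ node q₀ → T.Adj w (par w) := fun hw => parentGraph_adj_par hrank hw
  have hTadj : ∀ {v w : W}, T.Adj v w →
      (v ≠ node q₀ ∧ par v = w) ∨ (w ≠ node q₀ ∧ par w = v) := fun h => by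
    have h' : T.Adj _ _ := h
    rw [show T = parentGraph (node q₀) par from rfl, parentGraph, SimpleGraph.fromRel_adj] at h'
    exact h'.2
  have hleafnode : ∀ v q, leaf v ≠ node q := fun v q h => by cases h
  have hlinknode : ∀ z q, link z ≠ node q := fun v q h => by cases h
  have hnode : ∀ {p q}, node p = node q → p = q := fun h => Sum.inl_injective (Sum.inr_injective h)
  have hparleaf : ∀ w v, par w ≠ leaf v := by
    rintro (v | q | z) v' h <;> cases h
  have hleafadj : ∀ v w, T.Adj (leaf v) w ↔ w = node (rep v) := by
    intro v w
    constructor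
    · intro h
      rcases hTadj h with ⟨-, h⟩ | ⟨-, h⟩
      · exact h.symm
      · exact absurd h (hparleaf _ _)
    · rintro rfl
      exact hTpar (hleafnode _ _)
  have hleaf : ∀ v, IsLeaf T (leaf v) := fun v w hw w' hw' =>
    ((hleafadj v w).1 hw).trans ((hleafadj v w').1 hw').symm
  have hnodeleaf : ∀ q : R, T.Adj (node q) (leaf q) := fun q => by
    rw [T.adj_comm, hleafadj, hrep]
  -- the first representative has a neighbour that is not its leaf
  have hroot : ∃ w, w ≠ leaf q₀ ∧ T.Adj (node q₀) w := by
    -- Climb from the leaf of another vertex of `G` to the root. The last vertex before the root is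
    -- not `leaf q₀`, because leaves are never parents.
    have key : ∀ n w, rank w = n → w ≠ leaf q₀ → w ≠ node q₀ →
        ∃ w, w ≠ leaf q₀ ∧ T.Adj (node q₀) w := by
      intro n
      induction n using Nat.strong_induction_on with
      | _ n ih =>
        rintro w rfl h₁ h₂
        by_cases h : par w = node q₀
        · exact ⟨w, h₁, h ▸ (hTpar h₂).symm⟩
        · exact ih _ (hrank w h₂) _ rfl (hparleaf _ _) h
    obtain ⟨v, hv⟩ := exists_ne (q₀ : V)
    exact key _ (leaf v) rfl (fun h => hv (Sum.inl_injective h)) (hleafnode _ _)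
  have hnotleaf : ∀ q, ¬ IsLeaf T (node q) := by
    intro q hq
    by_cases h₀ : q = q₀
    · subst h₀
      obtain ⟨w, hw, hw'⟩ := hroot
      exact hw (hq hw' (hnodeleaf q))
    · exact hparleaf _ _ (hq (hTpar fun h => h₀ (hnode h)) (hnodeleaf q))
  have hnotlink : ∀ z, ¬ IsLeaf T (link z) := by
    intro z hz
    have h₁ : T.Adj (link z) (node q₀) := hTpar (hlinknode _ _)
    have h₂ : T.Adj (link z) (node z.1) := by
      have h := hTpar (w := node z.1) fun h => z.2.1 (hnode h)
      rcases hpre z.1 z.2.1 with ⟨u, -, hu, hlt⟩ | ⟨z', hz', heq⟩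
      · exact absurd hlt (z.2.2 u hu)
      · obtain rfl : z' = z := Subtype.ext heq
        have : par (node z'.1) = link z' := congrArg Sum.inr hz'
        rw [this] at h
        exact h.symm
    exact z.2.1 (hnode (hz h₂ h₁))
  have hnodepar : ∀ {p q : R}, p ≠ q₀ → (par (node p) = node q ↔ G.Adj p q ∧ f q < f p) := by
    intro p q hp
    have hpar : par (node p) = Sum.inr (pre p) := rfl
    rcases hpre p hp with ⟨u, hu, hpu, hlt⟩ | ⟨z, hz, rfl⟩
    · rw [hpar, hu]
      constructor
      · intro h
        obtain rfl : u = q := hnode h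
        exact ⟨hpu, hlt⟩
      · rintro ⟨hpq, hlt'⟩
        obtain rfl : u = q := Subtype.ext (huniq p u q p.2 u.2 q.2 hpu hpq hlt hlt')
        rfl
    · rw [hpar, hz]
      exact ⟨fun h => absurd h (hlinknode _ _), fun h => absurd h.2 (z.2.2 q h.1)⟩
  have hnodeadj : ∀ p q : R, T.Adj (node p) (node q) ↔ G.Adj p q := by
    have hback : ∀ {p q : R}, G.Adj p q → f q < f p → T.Adj (node p) (node q) := by
      intro p q h hlt
      have hp : p ≠ q₀ := by
        rintro rfl
        have := hq₀ q (fun h' => by simp [h'] at hlt)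
        omega
      have := hTpar (w := node p) fun h => hp (hnode h)
      rwa [(hnodepar hp).2 ⟨h, hlt⟩] at this
    intro p q
    constructor
    · intro h
      rcases hTadj h with ⟨h₀, h⟩ | ⟨h₀, h⟩
      · exact ((hnodepar fun h' => h₀ (congrArg node h')).1 h).1
      · exact ((hnodepar fun h' => h₀ (congrArg node h')).1 h).1.symm
    · intro h
      rcases lt_or_gt_of_ne (hf.ne h.ne) with hlt | hlt
      · exact (hback h.symm hlt).symm
      · exact hback h hlt
  let φ : V ≃ {w : W // IsLeaf T w} := Equiv.ofBijective (fun v => ⟨leaf v, hleaf v⟩) (by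
    constructor
    · intro u v h
      exact Sum.inl_injective (congrArg Subtype.val h)
    · rintro ⟨v | q | z, hw⟩
      · exact ⟨v, rfl⟩
      · exact absurd hw (hnotleaf q)
      · exact absurd hw (hnotlink z))
  refine ⟨W, inferInstance, T, φ, ⟨hT, fun u v huv => ?_⟩, node q₀, hnotleaf q₀⟩
  change _ ↔ T.dist (leaf u) (leaf v) ≤ 3
  rw [dist_le_three_iff hT.connected (fun h => huv (Sum.inl_injective h)) (hleafadj u)
    (hleafadj v) (hleafnode _ _).symm, hnodeadj, hadj u v huv]
  refine or_congr ?_ Iff.rfl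
  exact ⟨fun h => congrArg node (Subtype.ext h), fun h => congrArg Subtype.val (hnode h)⟩

theorem exists_isLeafRoot [Fintype V] [Nontrivial V] (hchordal : IsChordal G)
    (hbull : IsFree bull G) (hdart : IsFree dart G) (hgem : IsFree gem G) :
    ∃ (W : Type u) (_ : Fintype W) (T : SimpleGraph W) (φ : V ≃ {w : W // IsLeaf T w}),
      IsLeafRoot 3 G T φ ∧ ∃ x, ¬ IsLeaf T x := by
  obtain ⟨f, hf, hclique⟩ := hchordal.exists_earlierNeighborsClique
  -- The choice depends only on the closed neighbourhood, so twins receive the same representative.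
  let r : V → V := fun v => Classical.epsilon fun w => closedNeighborSet G w = closedNeighborSet G v
  have hr : ∀ v, closedNeighborSet G (r v) = closedNeighborSet G v := fun v =>
    Classical.epsilon_spec (p := fun w => closedNeighborSet G w = closedNeighborSet G v) ⟨v, rfl⟩
  have hiff : ∀ u v, closedNeighborSet G u = closedNeighborSet G v ↔ r u = r v := by
    intro u v
    constructor
    · intro h
      simp only [r, h]
    · intro h
      rw [← hr u, h, hr v]
  refine exists_isLeafRoot_of_forest hf (fun v => (hiff _ _).1 (hr v)) ?_
    (fun u v huv => adj_iff_of_closedNeighborSet_eq huv (hr u) (hr v) (hiff u v))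
  intro p u w hp hu hw hpu hpw hup hwp
  by_contra huw
  have hne : ∀ {a b : V}, r a = a → r b = b → a ≠ b →
      closedNeighborSet G a ≠ closedNeighborSet G b := by
    intro a b ha hb hab h
    rw [hiff, ha, hb] at h
    exact hab h
  exact false_of_triangle_without_twins hf hclique hbull hdart hgem hpu hpw
    (hclique u p w hpu hpw hup hwp huw) (hne hp hu hpu.ne) (hne hp hw hpw.ne) (hne hu hw huw)

theorem IsLeafRoot.isLeafPower {W : Type*} [Fintype W] {k : ℕ} {T : SimpleGraph W}
    {φ : V ≃ {w : W // IsLeaf T w}} (h : IsLeafRoot k G T φ) : IsLeafPower k G := by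
  let e : Fin (Fintype.card W) ≃ W := (Fintype.equivFin W).symm
  let T' : SimpleGraph (Fin (Fintype.card W)) := T.comap e
  let i : T' ≃g T := SimpleGraph.Iso.comap e T
  have hleaf : ∀ w, IsLeaf T w ↔ IsLeaf T' (e.symm w) := by
    intro w
    constructor
    · intro hw a ha b hb
      apply e.injective
      exact hw (by simpa [T'] using ha) (by simpa [T'] using hb)
    · intro hw a ha b hb
      apply e.symm.injective
      exact hw (by simpa [T'] using ha) (by simpa [T'] using hb)
  have hdistle : ∀ a b, T'.dist (e.symm a) (e.symm b) ≤ k ↔ T.dist a b ≤ k := by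
    have hT := h.isTree.connected
    have hT' : T'.Connected := i.connected_iff.2 hT
    intro a b
    constructor
    · intro hk
      obtain ⟨p, hp⟩ := hT'.exists_walk_length_eq_dist (e.symm a) (e.symm b)
      have := SimpleGraph.dist_le (p.map i.toHom)
      rw [SimpleGraph.Walk.length_map, hp] at this
      have hi : ∀ a, i (e.symm a) = a := e.apply_symm_apply
      change T.dist (i (e.symm a)) (i (e.symm b)) ≤ _ at this
      rw [hi, hi] at this
      exact this.trans hk
    · intro hk
      obtain ⟨p, hp⟩ := hT.exists_walk_length_eq_dist a b
      have := SimpleGraph.dist_le (p.map i.symm.toHom)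
      rw [SimpleGraph.Walk.length_map, hp] at this
      exact this.trans hk
  refine ⟨_, T', φ.trans (e.symm.subtypeEquiv hleaf), i.isTree_iff.2 h.isTree, fun u v huv => ?_⟩
  rw [h.adj_iff u v huv]
  exact (hdistle _ _).symm

theorem isLeafPower_of_subsingleton [Nonempty V] [Subsingleton V] (k : ℕ) : IsLeafPower k G := by
  let φ : V ≃ {w : Unit // IsLeaf (⊥ : SimpleGraph Unit) w} :=
    { toFun := fun _ => ⟨(), Set.subsingleton_of_subsingleton⟩
      invFun := fun _ => Classical.arbitrary V
      left_inv := fun _ => Subsingleton.elim _ _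
      right_inv := fun _ => Subsingleton.elim _ _ }
  have : IsLeafRoot k G ⊥ φ := ⟨.of_subsingleton, fun u v huv => absurd (Subsingleton.elim u v) huv⟩
  exact this.isLeafPower

theorem isNonJumping_of_card_le_three [Fintype V] (h : Fintype.card V ≤ 3) : IsNonJumping G := by
  refine ⟨(Fintype.equivFin V).symm, fun i j k l hij hjk hkl => ?_⟩
  have := l.2
  simp only [Fin.lt_def] at hij hjk hkl
  omega

end LeafRoot

end NonJumping

theorem mainTheorem6 {V : Type*} [Fintype V] (G : SimpleGraph V)
    (hchordal : NonJumping.IsChordal G)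
    (hbull : NonJumping.IsFree NonJumping.bull G)
    (hdart : NonJumping.IsFree NonJumping.dart G)
    (hgem : NonJumping.IsFree NonJumping.gem G) :
    NonJumping.IsNonJumping G ∧
    (Nonempty V → NonJumping.IsLeafPower 3 G) ∧
    (∀ {W : Type*} [Fintype W] (T : SimpleGraph W)
      (φ : V ≃ {w : W // NonJumping.IsLeaf T w}), NonJumping.IsLeafRoot 3 G T φ →
      ∀ x : W, ¬ NonJumping.IsLeaf T x →
        (∃ ch : W → List W, NonJumping.IsDepthSorted T x ch) ∧
        ∀ ch : W → List W, NonJumping.IsDepthSorted T x ch →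
          ∃ γ : Fin (Fintype.card V) ≃ V,
            List.ofFn (fun i => (φ (γ i) : W)) = NonJumping.dfsLeafOrder T x ch ∧
            NonJumping.IsNonJumpingLabeling G γ) := by
  refine ⟨?_, fun hV => ?_, fun T φ hφ x hx => ⟨NonJumping.exists_isDepthSorted T x,
    fun ch hch => NonJumping.exists_isNonJumpingLabeling_dfs hφ hx hch⟩⟩
  -- The constructed root has a non-leaf only when `V` has at least two vertices; below that the
  -- non-jumping condition is vacuous.
  · rcases Nat.lt_or_ge 1 (Fintype.card V) with hcard | hcard
    · have := Fintype.one_lt_card_iff_nontrivial.1 hcard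
      obtain ⟨W, _, T, φ, hφ, x, hx⟩ := NonJumping.exists_isLeafRoot hchordal hbull hdart hgem
      obtain ⟨ch, hch⟩ := NonJumping.exists_isDepthSorted T x
      obtain ⟨γ, -, hγ⟩ := NonJumping.exists_isNonJumpingLabeling_dfs hφ hx hch
      exact ⟨γ, hγ⟩
    · exact NonJumping.isNonJumping_of_card_le_three (by omega)
  · rcases subsingleton_or_nontrivial V with _ | _
    · exact NonJumping.isLeafPower_of_subsingleton 3
    · obtain ⟨W, _, T, φ, hφ, -⟩ := NonJumping.exists_isLeafRoot hchordal hbull hdart hgem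
      exact hφ.isLeafPower
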